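/- Let $A,C>0$ be real, and let $\mathcal F^{A,C}_{\exp}$ be the class of entire functions $f:\mathbb C\to\mathbb C$ with $|f(z)|\le C e^{A|z|}$ for all $z\in\mathbb C$, equipped with the metric $d_1(f,g)=\sup_{|z|<1}|f(z)-g(z)|$. For a subset $K$ of a metric space $(X,d)$ and $\varepsilon>0$, let $N(\varepsilon;K,d)$ be the least number of points $x_1,\dots,x_N\in X$ such that every $x\in K$ satisfies $d(x,x_i)\le\varepsilon$ for some $i$, and let $H(\varepsilon;K,d)=\log_2 N(\varepsilon;K,d)$. Let $W$ be the Lambert function: for $x\ge 0$, $W(x)$ is the unique real number with $W(x)e^{W(x)}=x$. For $0<\varepsilon\le 1$ put $$\beta_1(\varepsilon)=W\Big(\frac{2\ln(\varepsilon^{-1})}{eA}\Big),\qquad \beta_2(\varepsilon)=W\Big(\frac{\ln(\varepsilon^{-1})}{eA}\Big).$$ Then there are functions $R_1,R_2:\mathbb R\to\mathbb R$, depending only on $A$ and $C$, with $R_i(\beta)=O(e^{-\beta})$ as $\beta\to\infty$ for $i=1,2$, such that for every $\varepsilon\in(0,1]$ the covering number $N(\varepsilon;\mathcal F^{A,C}_{\exp},d_1)$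 is finite and $$\Big(\frac{eA}{2}\Big)^2\frac{e^{2\beta_1(\varepsilon)}}{\ln 2}\Big[\beta_1(\varepsilon)+\frac12\Big]\big[1+R_1(\beta_1(\varepsilon))\big]\;\le\; H(\varepsilon;\mathcal F^{A,C}_{\exp},d_1)\;\le\;(eA)^2\frac{e^{2\beta_2(\varepsilon)}}{\ln 2}\Big[\beta_2(\varepsilon)+\frac12\Big]\big[1+R_2(\beta_2(\varepsilon))\big].$$ This holds, with the same $R_1,R_2$, whichever metric space $X$ containing $(\mathcal F^{A,C}_{\exp},d_1)$ isometrically the centres of the coverings are taken from (for instance the class itself, or the space of all entire functions with the metric $d_1$). -/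

import Mathlib

/-- An entire function `ℂ → ℂ`. -/
@[ext]
structure EntireFunction where
  toFun : ℂ → ℂ
  differentiable : Differentiable ℂ toFun

namespace EntireFunction

instance : CoeFun EntireFunction (fun _ => ℂ → ℂ) := ⟨EntireFunction.toFun⟩

/-- The distance `d₁(f, g) = sup_{|z| < 1} |f z - g z|`. -/
noncomputable instance : Dist EntireFunction :=
  ⟨fun f g => ⨆ z : Metric.ball (0 : ℂ) 1, ‖f z - g z‖⟩

theorem dist_def (f g : EntireFunction) :
    dist f g = ⨆ z : Metric.ball (0 : ℂ) 1, ‖f z - g z‖ := rfl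

theorem bddAbove_norm_sub (f g : EntireFunction) :
    BddAbove (Set.range fun z : Metric.ball (0 : ℂ) 1 => ‖f z - g z‖) := by
  have hc : Continuous fun z : ℂ => ‖f z - g z‖ :=
    (f.differentiable.continuous.sub g.differentiable.continuous).norm
  obtain ⟨M, hM⟩ := ((isCompact_closedBall (0 : ℂ) 1).image hc).bddAbove
  refine ⟨M, ?_⟩
  rintro _ ⟨z, rfl⟩
  exact hM ⟨z, Metric.ball_subset_closedBall z.2, rfl⟩

theorem norm_sub_le_dist (f g : EntireFunction) (z : Metric.ball (0 : ℂ) 1) :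
    ‖f z - g z‖ ≤ dist f g :=
  le_ciSup (bddAbove_norm_sub f g) z

/-- The sup metric `d₁` over the open unit disk, on entire functions. -/
noncomputable instance : MetricSpace EntireFunction where
  dist_self f := by simp [dist_def]
  dist_comm f g := by simp only [dist_def, norm_sub_rev]
  dist_triangle f g h := by
    haveI : Nonempty (Metric.ball (0 : ℂ) 1) := ⟨⟨0, Metric.mem_ball_self one_pos⟩⟩
    rw [dist_def f h]
    refine ciSup_le fun z => ?_
    exact (norm_sub_le_norm_sub_add_norm_sub _ (g z) _).trans
      (add_le_add (norm_sub_le_dist f g z) (norm_sub_le_dist g h z))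
  eq_of_dist_eq_zero {f g} hfg := by
    have hloc : f.toFun =ᶠ[nhds 0] g.toFun := by
      filter_upwards [Metric.ball_mem_nhds (0 : ℂ) one_pos] with z hz
      have h := norm_sub_le_dist f g ⟨z, hz⟩
      rw [hfg] at h
      exact sub_eq_zero.mp (norm_le_zero_iff.mp h)
    have hf : AnalyticOnNhd ℂ f.toFun Set.univ :=
      f.differentiable.differentiableOn.analyticOnNhd isOpen_univ
    have hg : AnalyticOnNhd ℂ g.toFun Set.univ :=
      g.differentiable.differentiableOn.analyticOnNhd isOpen_univ
    exact EntireFunction.ext (hf.eq_of_eventuallyEq hg hloc)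

end EntireFunction

/-- The class of entire functions `f` with `|f z| ≤ C e^{A|z|}` for all `z`. -/
def expTypeClass (A C : ℝ) : Set EntireFunction :=
  {f | ∀ z : ℂ, ‖f z‖ ≤ C * Real.exp (A * ‖z‖)}

/-- The metric entropy `log₂ N(ε; K, d)` of a subset `K` of a metric space `X`, where `N` is the
least number of closed balls of radius `ε`, centred at points of `X`, that cover `K`.
It is meaningful only when that number is finite. -/
noncomputable def metricEntropy {X : Type*} [MetricSpace X] (ε : ℝ) (K : Set X) : ℝ :=
  Real.logb 2 ((Metric.externalCoveringNumber ε.toNNReal K).toNat : ℝ)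

theorem exists_mul_exp_eq {x : ℝ} (hx : 0 ≤ x) : ∃ w : ℝ, 0 ≤ w ∧ w * Real.exp w = x := by
  have hc : ContinuousOn (fun w : ℝ => w * Real.exp w) (Set.Icc 0 x) := by fun_prop
  have hmem : x ∈ Set.Icc ((fun w : ℝ => w * Real.exp w) 0) ((fun w : ℝ => w * Real.exp w) x) := by
    refine ⟨by simpa using hx, ?_⟩
    exact le_mul_of_one_le_right hx (Real.one_le_exp hx)
  obtain ⟨w, hw, hwx⟩ := intermediate_value_Icc hx hc hmem
  exact ⟨w, hw.1, hwx⟩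

open Classical in
/-- The Lambert function: for `x ≥ 0`, the unique real `w` with `w e^w = x`
(which is nonnegative); the value for `x < 0` is irrelevant. -/
noncomputable def lambertW (x : ℝ) : ℝ :=
  if hx : 0 ≤ x then (exists_mul_exp_eq hx).choose else 0

theorem lambertW_nonneg (x : ℝ) : 0 ≤ lambertW x := by
  unfold lambertW
  split_ifs with hx
  · exact (exists_mul_exp_eq hx).choose_spec.1
  · exact le_rfl

theorem lambertW_mul_exp {x : ℝ} (hx : 0 ≤ x) :
    lambertW x * Real.exp (lambertW x) = x := by
  unfold lambertW
  rw [dif_pos hx]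
  exact (exists_mul_exp_eq hx).choose_spec.2

theorem lambertW_unique {x w : ℝ} (hx : 0 ≤ x) (hw : w * Real.exp w = x) : lambertW x = w := by
  have hw0 : 0 ≤ w := by
    by_contra! h
    exact absurd (hw ▸ hx) (not_le.mpr (mul_neg_of_neg_of_pos h (Real.exp_pos w)))
  have key : ∀ a b : ℝ, 0 ≤ a → a < b → a * Real.exp a < b * Real.exp b := fun a b ha hab =>
    mul_lt_mul'' hab (Real.exp_lt_exp.mpr hab) ha (Real.exp_pos a).le
  have h := lambertW_mul_exp hx
  rcases lt_trichotomy (lambertW x) w with hlt | heq | hgt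
  · have := key _ _ (lambertW_nonneg x) hlt
    linarith
  · exact heq
  · have := key _ _ hw0 hgt
    linarith

/-! The problem reduces to counting Taylor coefficients. Cauchy's estimate bounds the `n`-th
coefficient on the class by `C (a/n)^n` with `a = eA`. Conversely, polynomials with coefficients at
most `(C/2) (a/n)^n`, now with `a = eA/2`, belong to the class; the halving buys a convergent
geometric series and accounts for the gap between the two bounds.

For the upper bound, the first `K` coefficients are rounded to a grid and the tail is negligible
(`exists_nat_externalCoveringNumber_le`). For the lower bound, coefficients on a grid of spacing
`3ε` give points more than `2ε` apart (`exists_nat_le_externalCoveringNumber`). Both counts use only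
distances within the class, so the ambient space is irrelevant.

With `L = log (1/ε)`, either logarithm is about twice the sum of `L - n log (n/a)` over `n ≤ M`,
where `M log (M/a) = L`. Putting `M = a e^β` turns this into Lambert's equation `β e^β = L/a`.
Comparison with an integral gives `M² (β + 1/2)` up to `O(M (β + 1))`, a relative error `O(1/M) =
O(e^{-β})`. -/

/-! ### Covering numbers from codes and from separated families -/

open Metric in
/-- A map into a finite set whose fibres have small diameter bounds the covering number. -/
theorem externalCoveringNumber_range_le_card {X Y T : Type*} [PseudoEMetricSpace X] {ε : NNReal}
    (g : Y → X) (code : Y → T) (s : Finset T) (hs : ∀ y, code y ∈ s)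
    (hd : ∀ y y', code y = code y' → edist (g y) (g y') ≤ ε) :
    externalCoveringNumber ε (Set.range g) ≤ (s.card : ℕ∞) := by
  classical
  let σ : Set.range code → Y := fun t => t.2.choose
  have hσ : ∀ t, code (σ t) = t := fun t => t.2.choose_spec
  have hcov : IsCover ε (Set.range g) (Set.range fun t => g (σ t)) := by
    rintro _ ⟨y, rfl⟩
    exact ⟨_, ⟨⟨code y, y, rfl⟩, rfl⟩, hd _ _ (hσ ⟨code y, y, rfl⟩).symm⟩
  refine hcov.externalCoveringNumber_le_encard.trans ?_
  rw [← Set.image_univ]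
  refine (Set.encard_image_le _ _).trans ?_
  rw [Set.encard_univ, ← Set.encard_coe_eq_coe_finsetCard]
  exact Set.encard_le_encard (s := Set.range code) (by rintro _ ⟨y, rfl⟩; exact hs y)

open Metric in
/-- A finite family of points at mutual distances greater than `2 * ε` bounds the covering number
from below. -/
theorem card_le_externalCoveringNumber {X T : Type*} [PseudoEMetricSpace X] [Fintype T]
    {ε : NNReal} {K : Set X} (p : T → X) (hp : ∀ t, p t ∈ K)
    (hsep : ∀ t t', t ≠ t' → ((2 * ε : NNReal) : ENNReal) < edist (p t) (p t')) :
    (Fintype.card T : ℕ∞) ≤ externalCoveringNumber ε K := by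
  refine le_trans ?_ (packingNumber_two_mul_le_externalCoveringNumber ε K)
  have hinj : Function.Injective p := by
    intro t t' h
    by_contra hne
    have := hsep t t' hne
    rw [h, edist_self] at this
    exact not_lt_bot this
  rw [← ENat.card_eq_coe_fintype_card, ← Set.encard_univ, ← hinj.encard_image, Set.image_univ]
  refine le_iSup₂_of_le (Set.range p) (by rintro _ ⟨t, rfl⟩; exact hp t) ?_
  refine le_iSup_of_le ?_ le_rfl
  rintro _ ⟨t, rfl⟩ _ ⟨t', rfl⟩ hne
  exact hsep t t' fun h => hne (h ▸ rfl)

/-! ### Taylor coefficients on the class -/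

namespace EntireFunction

/-- The `n`-th Taylor coefficient at the origin. -/
noncomputable def coeff (f : EntireFunction) (n : ℕ) : ℂ :=
  (n.factorial : ℂ)⁻¹ * iteratedDeriv n f.toFun 0

theorem hasSum_coeff (f : EntireFunction) (z : ℂ) :
    HasSum (fun n => f.coeff n * z ^ n) (f z) := by
  convert! Complex.hasSum_taylorSeries_of_entire f.differentiable 0 z using 2 with n
  simp only [coeff, sub_zero, smul_eq_mul]
  ring

theorem norm_inv_factorial_mul_iteratedDeriv_le {f : ℂ → ℂ} (hf : Differentiable ℂ f) (n : ℕ)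
    {R S : ℝ} (hR : 0 < R) (hS : ∀ z ∈ Metric.sphere (0 : ℂ) R, ‖f z‖ ≤ S) :
    ‖(n.factorial : ℂ)⁻¹ * iteratedDeriv n f 0‖ ≤ S / R ^ n := by
  have h := Complex.norm_iteratedDeriv_le_of_forall_mem_sphere_norm_le n hR hf.diffContOnCl hS
  have hn : (0 : ℝ) < n.factorial := by exact_mod_cast n.factorial_pos
  rw [norm_mul, norm_inv, Complex.norm_natCast, inv_mul_le_iff₀ hn, ← mul_div_assoc]
  exact h

/-- The radius `n / A` minimises `e^{AR} / R^n` in Cauchy's estimate. At `n = 0` the power is `1`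
and the bound is that of `f 0`. -/
theorem norm_coeff_le {A C : ℝ} (hA : 0 < A) {f : EntireFunction} (hf : f ∈ expTypeClass A C)
    (n : ℕ) : ‖f.coeff n‖ ≤ C * (Real.exp 1 * A / n) ^ n := by
  rcases Nat.eq_zero_or_pos n with rfl | hn
  · have h0 := hf 0
    simpa [coeff] using h0
  · have hn' : (0 : ℝ) < n := by exact_mod_cast hn
    refine (norm_inv_factorial_mul_iteratedDeriv_le f.differentiable n (R := n / A)
      (S := C * Real.exp n) (by positivity) ?_).trans_eq ?_
    · intro z hz
      have h := hf z
      rw [mem_sphere_zero_iff_norm.1 hz, mul_div_cancel₀ _ hA.ne'] at h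
      exact h
    · rw [← Real.exp_one_pow, mul_div_assoc, ← div_pow]
      congr 2
      field_simp

/-- Continuity carries the bound to the unit circle, so that Cauchy's estimate at radius exactly `1`
loses no constant. -/
theorem norm_sub_le_dist_of_norm_le (f g : EntireFunction) {z : ℂ} (hz : ‖z‖ ≤ 1) :
    ‖f z - g z‖ ≤ dist f g := by
  have hcl : IsClosed {z : ℂ | ‖f z - g z‖ ≤ dist f g} :=
    isClosed_le (f.differentiable.continuous.sub g.differentiable.continuous).norm
      continuous_const
  have hsub : Metric.ball (0 : ℂ) 1 ⊆ {z : ℂ | ‖f z - g z‖ ≤ dist f g} :=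
    fun z hz => norm_sub_le_dist f g ⟨z, hz⟩
  have h := closure_minimal hsub hcl
  rw [closure_ball _ one_ne_zero] at h
  exact h (mem_closedBall_zero_iff.2 hz)

theorem norm_coeff_sub_le_dist (f g : EntireFunction) (n : ℕ) :
    ‖f.coeff n - g.coeff n‖ ≤ dist f g := by
  have h := norm_inv_factorial_mul_iteratedDeriv_le (f.differentiable.sub g.differentiable) n
    one_pos (S := dist f g) fun z hz =>
      norm_sub_le_dist_of_norm_le f g (mem_sphere_zero_iff_norm.1 hz).le
  rw [iteratedDeriv_sub f.differentiable.contDiff.contDiffAt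
    g.differentiable.contDiff.contDiffAt, mul_sub, one_pow, div_one] at h
  exact h

theorem dist_le_of_hasSum {f g : EntireFunction} {b : ℕ → ℝ} {S : ℝ} (hb : HasSum b S)
    (h : ∀ n, ‖f.coeff n - g.coeff n‖ ≤ b n) : dist f g ≤ S := by
  have : Nonempty (Metric.ball (0 : ℂ) 1) := ⟨⟨0, Metric.mem_ball_self one_pos⟩⟩
  rw [dist_def]
  refine ciSup_le fun z => ?_
  have hz : ‖(z : ℂ)‖ ≤ 1 := (mem_ball_zero_iff.1 z.2).le
  have hs := (f.hasSum_coeff z).sub (g.hasSum_coeff z)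
  rw [← hs.tsum_eq]
  refine tsum_of_norm_bounded hb fun n => ?_
  rw [← sub_mul, norm_mul, norm_pow]
  exact (mul_le_of_le_one_right (norm_nonneg _) (pow_le_one₀ (norm_nonneg _) hz)).trans (h n)

/-- The entire function defined by a polynomial. -/
noncomputable def ofPolynomial (p : Polynomial ℂ) : EntireFunction :=
  ⟨fun z => p.eval z, p.differentiable⟩

theorem coeff_ofPolynomial (p : Polynomial ℂ) (n : ℕ) : (ofPolynomial p).coeff n = p.coeff n := by
  have h : ∀ n, iteratedDeriv n (fun z => p.eval z) =
      fun z => ((Polynomial.derivative)^[n] p).eval z := by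
    intro n
    induction n with
    | zero => simp
    | succ n ih =>
      rw [iteratedDeriv_succ, ih]
      ext z
      rw [Polynomial.deriv, Function.iterate_succ_apply']
  have hn : (n.factorial : ℂ) ≠ 0 := by exact_mod_cast n.factorial_ne_zero
  simp only [coeff, ofPolynomial]
  rw [h n]
  simp only
  rw [← Polynomial.coeff_zero_eq_eval_zero, Polynomial.coeff_iterate_derivative, zero_add,
    Nat.descFactorial_self, nsmul_eq_mul, inv_mul_cancel_left₀ hn]

/-- Since `(eA|z|/n)^n ≤ e^{A|z|}`, halving the base leaves a factor `2^{-n}`, and these factors sum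
to `2`, cancelling the `1/2` in `C / 2`. -/
theorem ofPolynomial_mem_expTypeClass {A C : ℝ} (hA : 0 < A) (hC : 0 < C) {p : Polynomial ℂ}
    (hp : ∀ n, ‖p.coeff n‖ ≤ C / 2 * (Real.exp 1 * A / 2 / n) ^ n) :
    ofPolynomial p ∈ expTypeClass A C := by
  intro z
  have key : ∀ n : ℕ, (Real.exp 1 * A * ‖z‖ / n) ^ n ≤ Real.exp (A * ‖z‖) := by
    intro n
    rcases Nat.eq_zero_or_pos n with rfl | hn
    · simpa using by positivity
    · have hn' : (0 : ℝ) < n := by exact_mod_cast hn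
      have h1 : Real.exp 1 * A * ‖z‖ / n ≤ Real.exp (A * ‖z‖ / n) := by
        -- This is `e t ≤ e^t` at `t = A|z|/n`.
        have h := Real.add_one_le_exp (A * ‖z‖ / n - 1)
        rw [sub_add_cancel, Real.exp_sub, le_div_iff₀ (Real.exp_pos 1)] at h
        refine le_trans (le_of_eq ?_) h
        ring
      refine (pow_le_pow_left₀ (by positivity) h1 n).trans_eq ?_
      rw [← Real.exp_nat_mul]
      congr 1
      field_simp
  have hgeo : HasSum (fun n : ℕ => C * Real.exp (A * ‖z‖) / 2 * (1 / 2 : ℝ) ^ n)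
      (C * Real.exp (A * ‖z‖)) := by
    have h := hasSum_geometric_two.mul_left (C * Real.exp (A * ‖z‖) / 2)
    rwa [div_mul_cancel₀ _ two_ne_zero] at h
  rw [← ((ofPolynomial p).hasSum_coeff z).tsum_eq]
  refine tsum_of_norm_bounded hgeo fun n => ?_
  rw [norm_mul, norm_pow, coeff_ofPolynomial]
  calc ‖p.coeff n‖ * ‖z‖ ^ n
      ≤ C / 2 * (Real.exp 1 * A / 2 / n) ^ n * ‖z‖ ^ n := by gcongr; exact hp n
    _ = C / 2 * (1 / 2) ^ n * (Real.exp 1 * A * ‖z‖ / n) ^ n := by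
        rw [mul_assoc, mul_assoc, ← mul_pow, ← mul_pow]; congr 2; ring
    _ ≤ C / 2 * (1 / 2) ^ n * Real.exp (A * ‖z‖) := by gcongr; exact key n
    _ = C * Real.exp (A * ‖z‖) / 2 * (1 / 2 : ℝ) ^ n := by ring

end EntireFunction

/-! ### Comparing the sum of `n log (n/a)` with its integral -/

/-- The function `x ↦ x log (x / a)`. -/
noncomputable def mulLogDiv (a x : ℝ) : ℝ := x * Real.log (x / a)

/-- An antiderivative of `mulLogDiv a`. -/
noncomputable def mulLogDivPrimitive (a x : ℝ) : ℝ := x ^ 2 / 2 * Real.log (x / a) - x ^ 2 / 4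

section

variable {a : ℝ}

/-- Convexity: the graph lies above its tangents, by `log t ≥ 1 - 1/t` at `t = y/x`. -/
theorem mulLogDiv_tangent (ha : 0 < a) {x y : ℝ} (hx : 0 < x) (hy : 0 ≤ y) :
    mulLogDiv a x + (Real.log (x / a) + 1) * (y - x) ≤ mulLogDiv a y := by
  unfold mulLogDiv
  rcases hy.eq_or_lt with rfl | hy
  · simp only [zero_mul]; nlinarith
  · have h := Real.one_sub_inv_le_log_of_pos (div_pos hy hx)
    rw [Real.log_div hy.ne' hx.ne', inv_div] at h
    rw [Real.log_div hx.ne' ha.ne', Real.log_div hy.ne' ha.ne']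
    have h2 := mul_le_mul_of_nonneg_left h hy.le
    have h3 : y * (1 - x / y) = y - x := by field_simp
    rw [h3] at h2
    linarith

theorem neg_le_mulLogDiv (ha : 0 < a) {y : ℝ} (hy : 0 ≤ y) : -a ≤ mulLogDiv a y := by
  have h := mulLogDiv_tangent ha ha hy
  simp only [mulLogDiv, div_self ha.ne', Real.log_one] at h ⊢
  linarith

/-- The function decreases before it increases; the slack `a` pays for the dip, so it can be treated
as monotone. -/
theorem mulLogDiv_le_add (ha : 0 < a) {x y : ℝ} (hx : 0 ≤ x) (hxy : x ≤ y) :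
    mulLogDiv a x ≤ mulLogDiv a y + a := by
  rcases hx.eq_or_lt with rfl | hx0
  · have := neg_le_mulLogDiv ha hxy
    simp only [mulLogDiv, zero_mul] at this ⊢
    linarith
  rcases le_total a x with h | h
  · have h1 : 0 ≤ Real.log (x / a) := Real.log_nonneg ((one_le_div ha).2 h)
    have h2 := mulLogDiv_tangent ha hx0 (hx.trans hxy)
    have h3 : 0 ≤ (Real.log (x / a) + 1) * (y - x) :=
      mul_nonneg (by linarith) (by linarith)
    linarith
  · have h1 : Real.log (x / a) ≤ 0 :=
      Real.log_nonpos (by positivity) ((div_le_one ha).2 h)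
    have h2 := neg_le_mulLogDiv ha (hx.trans hxy)
    have h3 : mulLogDiv a x ≤ 0 := mul_nonpos_of_nonneg_of_nonpos hx h1
    linarith

theorem continuous_mulLogDivPrimitive (ha : 0 < a) : Continuous (mulLogDivPrimitive a) := by
  have h : mulLogDivPrimitive a =
      fun x => a * x / 2 * (x / a * Real.log (x / a)) - x ^ 2 / 4 := by
    ext x
    unfold mulLogDivPrimitive
    field_simp
  rw [h]
  have := Real.continuous_mul_log.comp (continuous_id.div_const a)
  simp only [Function.comp_def, id] at this
  fun_prop

theorem hasDerivAt_mulLogDivPrimitive (ha : 0 < a) {x : ℝ} (hx : 0 < x) :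
    HasDerivAt (mulLogDivPrimitive a) (mulLogDiv a x) x := by
  have h1 : HasDerivAt (fun x => Real.log (x / a)) (1 / a / (x / a)) x :=
    ((hasDerivAt_id x).div_const a).log (by simp; exact ⟨hx.ne', ha.ne'⟩)
  have h2 : HasDerivAt (fun x : ℝ => x ^ 2) (2 * x) x := by
    simpa using hasDerivAt_pow 2 x
  convert! ((h2.div_const 2).mul h1).sub (h2.div_const 4) using 1
  unfold mulLogDiv
  field_simp
  ring

theorem mulLogDivPrimitive_sub (ha : 0 < a) {x y : ℝ} (hx : 0 ≤ x) (hxy : x ≤ y) :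
    (mulLogDiv a x - a) * (y - x) ≤ mulLogDivPrimitive a y - mulLogDivPrimitive a x ∧
      mulLogDivPrimitive a y - mulLogDivPrimitive a x ≤ (mulLogDiv a y + a) * (y - x) := by
  have hc := (continuous_mulLogDivPrimitive ha).continuousOn (s := Set.Icc x y)
  have hd : ∀ t ∈ interior (Set.Icc x y),
      HasDerivAt (mulLogDivPrimitive a) (mulLogDiv a t) t := by
    intro t ht
    rw [interior_Icc] at ht
    exact hasDerivAt_mulLogDivPrimitive ha (hx.trans_lt ht.1)
  have hdiff : DifferentiableOn ℝ (mulLogDivPrimitive a) (interior (Set.Icc x y)) :=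
    fun t ht => (hd t ht).differentiableAt.differentiableWithinAt
  have hxm : x ∈ Set.Icc x y := ⟨le_rfl, hxy⟩
  have hym : y ∈ Set.Icc x y := ⟨hxy, le_rfl⟩
  constructor
  · refine (convex_Icc x y).mul_sub_le_image_sub_of_le_deriv hc hdiff ?_ x hxm y hym hxy
    intro t ht
    rw [(hd t ht).deriv]
    have := mulLogDiv_le_add ha hx (interior_subset ht).1
    linarith
  · refine (convex_Icc x y).image_sub_le_mul_sub_of_deriv_le hc hdiff ?_ x hxm y hym hxy
    intro t ht
    rw [(hd t ht).deriv]
    exact mulLogDiv_le_add ha (hx.trans (interior_subset ht).1) (interior_subset ht).2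

/-- Near-monotonicity costs at most `a` on each unit interval, and the increments of the primitive
telescope. -/
theorem sum_mulLogDiv_le (ha : 0 < a) (K : ℕ) :
    ∑ n ∈ Finset.range K, mulLogDiv a n ≤ mulLogDivPrimitive a K + a * K := by
  induction K with
  | zero => simp [mulLogDivPrimitive]
  | succ K ih =>
    have h := (mulLogDivPrimitive_sub ha (Nat.cast_nonneg (α := ℝ) K)
      (show (K : ℝ) ≤ ((K + 1 : ℕ) : ℝ) by push_cast; linarith)).1
    rw [Finset.sum_range_succ]
    push_cast at h ⊢
    linarith

theorem le_sum_mulLogDiv (ha : 0 < a) (K : ℕ) :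
    mulLogDivPrimitive a K - a * K ≤ ∑ n ∈ Finset.range (K + 1), mulLogDiv a n := by
  induction K with
  | zero => simp [mulLogDivPrimitive, mulLogDiv]
  | succ K ih =>
    have h := (mulLogDivPrimitive_sub ha (Nat.cast_nonneg (α := ℝ) K)
      (show (K : ℝ) ≤ ((K + 1 : ℕ) : ℝ) by push_cast; linarith)).2
    rw [Finset.sum_range_succ]
    push_cast at h ⊢
    linarith

theorem exp_neg_mulLogDiv (ha : 0 < a) (n : ℕ) :
    Real.exp (-mulLogDiv a n) = (a / n) ^ n := by
  rcases Nat.eq_zero_or_pos n with rfl | hn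
  · simp [mulLogDiv]
  · have hn' : (0 : ℝ) < n := by exact_mod_cast hn
    unfold mulLogDiv
    rw [← mul_neg, ← Real.log_inv, inv_div, Real.exp_nat_mul, Real.exp_log (by positivity)]

variable {β : ℝ}

theorem mulLogDiv_mul_exp (ha : 0 < a) :
    mulLogDiv a (a * Real.exp β) = a * Real.exp β * β := by
  rw [mulLogDiv, mul_div_cancel_left₀ _ ha.ne', Real.log_exp]

theorem mulLogDivPrimitive_mul_exp (ha : 0 < a) :
    mulLogDivPrimitive a (a * Real.exp β) =
      a * Real.exp β * β * (a * Real.exp β) - (a * Real.exp β) ^ 2 / 2 * (β + 1 / 2) := by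
  rw [mulLogDivPrimitive, mul_div_cancel_left₀ _ ha.ne', Real.log_exp]
  ring

/-- The tangent at `a e^β` has slope `β + 1 ≥ 1`. Past that point the coefficient bounds therefore
decay at least like `e^{-n}`. -/
theorem mulLogDiv_mul_exp_add_le (ha : 0 < a) (hβ : 0 ≤ β) {x : ℝ} (hx : a * Real.exp β ≤ x) :
    a * Real.exp β * β + (x - a * Real.exp β) ≤ mulLogDiv a x := by
  have hM : 0 < a * Real.exp β := by positivity
  have h := mulLogDiv_tangent ha hM (hM.le.trans hx)
  rw [mulLogDiv_mul_exp ha, mul_div_cancel_left₀ _ ha.ne', Real.log_exp] at h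
  nlinarith

theorem mulLogDiv_le_of_le_mul_exp (ha : 0 < a) (hβ : 0 ≤ β) {x : ℝ} (hx0 : 0 ≤ x)
    (hx : x ≤ a * Real.exp β) : mulLogDiv a x ≤ a * Real.exp β * β := by
  rcases hx0.eq_or_lt with rfl | hx0
  · simp only [mulLogDiv, zero_mul]; positivity
  · have h : Real.log (x / a) ≤ β := by
      rw [Real.log_le_iff_le_exp (by positivity), div_le_iff₀ ha]
      linarith
    exact (mul_le_mul_of_nonneg_left h hx0.le).trans (mul_le_mul_of_nonneg_right hx hβ)

/-- The primitive at `M` is `L M` minus the main term, so the `L M` cancels; `L` and `a M` are the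
rounding and comparison errors. -/
theorem sum_sub_mulLogDiv_le (ha : 0 < a) {M L : ℝ} (hM : M = a * Real.exp β)
    (hL : L = M * β) :
    ∑ n ∈ Finset.range (⌊M⌋₊ + 1), (L - mulLogDiv a n) ≤
      M ^ 2 / 2 * (β + 1 / 2) + L + a * M := by
  have hM0 : 0 ≤ M := by rw [hM]; positivity
  have h1 := le_sum_mulLogDiv ha ⌊M⌋₊
  have hm := Nat.floor_le hM0
  have h2 := (mulLogDivPrimitive_sub ha (Nat.cast_nonneg (α := ℝ) ⌊M⌋₊) hm).2
  have h3 : mulLogDiv a M = L := by rw [hL, hM, mulLogDiv_mul_exp ha]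
  have h4 : mulLogDivPrimitive a M = L * M - M ^ 2 / 2 * (β + 1 / 2) := by
    rw [hL, hM, mulLogDivPrimitive_mul_exp ha]
  rw [h3, h4] at h2
  rw [Finset.sum_sub_distrib, Finset.sum_const, Finset.card_range, nsmul_eq_mul]
  push_cast
  linarith

theorem le_sum_sub_mulLogDiv (ha : 0 < a) (hβ : 0 ≤ β) {M L : ℝ} (hM : M = a * Real.exp β)
    (hL : L = M * β) :
    M ^ 2 / 2 * (β + 1 / 2) - L - a * M - 2 * a ≤
      ∑ n ∈ Finset.range ⌊M⌋₊, (L - mulLogDiv a n) := by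
  have hM0 : 0 ≤ M := by rw [hM]; positivity
  have hL0 : 0 ≤ L := by rw [hL]; positivity
  have h1 := sum_mulLogDiv_le ha ⌊M⌋₊
  have hm := Nat.floor_le hM0
  have hm' := Nat.lt_floor_add_one M
  have h2 := (mulLogDivPrimitive_sub ha (Nat.cast_nonneg (α := ℝ) ⌊M⌋₊) hm).1
  have h3 := neg_le_mulLogDiv ha (Nat.cast_nonneg (α := ℝ) ⌊M⌋₊)
  have h4 : mulLogDivPrimitive a M = L * M - M ^ 2 / 2 * (β + 1 / 2) := by
    rw [hL, hM, mulLogDivPrimitive_mul_exp ha]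
  rw [h4] at h2
  rw [Finset.sum_sub_distrib, Finset.sum_const, Finset.card_range, nsmul_eq_mul]
  have h5 : -(2 * a) ≤ (mulLogDiv a ⌊M⌋₊ - a) * (M - ⌊M⌋₊) := by nlinarith
  have h6 : L * M - L ≤ ⌊M⌋₊ * L := by nlinarith
  have h7 : a * ⌊M⌋₊ ≤ a * M := by gcongr
  linarith

end

/-! ### Upper bound: rounding coefficients to a grid -/

theorem norm_sub_le_of_floor_eq {δ : ℝ} (hδ : 0 < δ) {z w : ℂ}
    (hre : ⌊z.re / δ⌋ = ⌊w.re / δ⌋) (him : ⌊z.im / δ⌋ = ⌊w.im / δ⌋) : ‖z - w‖ ≤ 2 * δ := by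
  have h1 := (Int.abs_sub_lt_one_of_floor_eq_floor hre).le
  have h2 := (Int.abs_sub_lt_one_of_floor_eq_floor him).le
  rw [← sub_div, abs_div, abs_of_pos hδ, div_le_one hδ] at h1 h2
  have h3 := Complex.norm_le_abs_re_add_abs_im (z - w)
  rw [Complex.sub_re, Complex.sub_im] at h3
  linarith

theorem floor_div_mem_Icc {δ r x : ℝ} (hδ : 0 < δ) (hx : |x| ≤ r) :
    ⌊x / δ⌋ ∈ Finset.Icc ⌊-(r / δ)⌋ ⌊r / δ⌋ := by
  rw [abs_le] at hx
  rw [Finset.mem_Icc, ← neg_div]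
  exact ⟨Int.floor_mono (by gcongr; exact hx.1), Int.floor_mono (by gcongr; exact hx.2)⟩

theorem card_Icc_floor_le {r : ℝ} (hr : 0 ≤ r) :
    ((Finset.Icc ⌊-r⌋ ⌊r⌋).card : ℝ) ≤ 2 * r + 2 := by
  have h1 := Int.floor_le r
  have h2 := Int.lt_floor_add_one (-r)
  have h3 : (0 : ℤ) ≤ ⌊r⌋ + 1 - ⌊-r⌋ := by
    have : ⌊-r⌋ ≤ ⌊r⌋ := Int.floor_mono (by linarith)
    omega
  rw [Int.card_Icc, ← Int.cast_natCast, Int.toNat_of_nonneg h3]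
  push_cast
  linarith

/-- The error budget: half of `ε` is shared equally by the first `K` coefficients, half goes
geometrically to the tail. -/
theorem hasSum_const_geometric (ε : ℝ) {K : ℕ} (hK : 0 < K) :
    HasSum (fun n : ℕ => if n < K then ε / (2 * K) else ε / 4 * (1 / 2) ^ (n - K)) ε := by
  have hK' : (K : ℝ) ≠ 0 := by exact_mod_cast hK.ne'
  set b : ℕ → ℝ := fun n => if n < K then ε / (2 * K) else ε / 4 * (1 / 2) ^ (n - K) with hb
  have h1 : ∑ n ∈ Finset.range K, b n = ε / 2 := by
    rw [Finset.sum_congr rfl fun n hn => if_pos (Finset.mem_range.1 hn), Finset.sum_const,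
      Finset.card_range, nsmul_eq_mul]
    field_simp
  have h2 : (fun n => b (n + K)) = fun n => ε / 4 * (1 / 2) ^ n := by
    ext n
    rw [hb]
    simp only
    rw [if_neg (by omega), Nat.add_sub_cancel]
  have h3 : HasSum (fun n => b (n + K)) (ε / 2) := by
    have h := hasSum_geometric_two.mul_left (ε / 4)
    rw [h2]
    rwa [show ε / 4 * 2 = ε / 2 by ring] at h
  have h4 := (hasSum_nat_add_iff K).1 h3
  rwa [h1, add_halves] at h4

open Metric in
theorem exists_nat_externalCoveringNumber_le {A C : ℝ} (hA : 0 < A) (hC : 0 < C)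
    {X : Type*} [MetricSpace X] {ι : expTypeClass A C → X} (hι : Isometry ι)
    {ε β a M L : ℝ} (hβ : 0 ≤ β) (ha : a = Real.exp 1 * A) (hM : M = a * Real.exp β)
    (hL : L = M * β) (hε : ε = Real.exp (-L)) {j K : ℕ} (hj : 8 * C ≤ Real.exp j)
    (hK : K = ⌊M⌋₊ + 1 + j) :
    ∃ N : ℕ, 0 < N ∧ externalCoveringNumber ε.toNNReal (Set.range ι) ≤ N ∧
      Real.log N ≤ M ^ 2 * (β + 1 / 2) + 2 * (L + a * M) + 2 * K * Real.log (8 * C * K + 2) := by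
  have ha0 : 0 < a := by rw [ha]; positivity
  have hM0 : 0 < M := by rw [hM]; positivity
  have hε0 : 0 < ε := by rw [hε]; positivity
  have hK0 : 0 < K := by omega
  have hK0' : (0 : ℝ) < K := by exact_mod_cast hK0
  -- Equal codes leave an error of at most `2δ = ε / (2K)`, the share of one coefficient.
  set δ : ℝ := ε / (4 * K) with hδ
  have hδ0 : 0 < δ := by positivity
  set ρ : ℕ → ℝ := fun n => (a / n) ^ n with hρ
  have hρ0 : ∀ n, 0 ≤ ρ n := fun n => by positivity
  have hρε : ∀ n, ρ n = ε * Real.exp (L - mulLogDiv a n) := by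
    intro n
    rw [hρ, hε, ← Real.exp_add]
    simp only
    rw [← exp_neg_mulLogDiv ha0]
    congr 1
    ring
  have hcoef : ∀ (f : expTypeClass A C) n, ‖f.1.coeff n‖ ≤ C * ρ n := by
    intro f n
    have := EntireFunction.norm_coeff_le hA f.2 n
    rwa [← ha] at this
  -- The `j` extra coefficients past `M` gain `e^{-j}`, which absorbs `C`.
  have htail : ∀ n, K ≤ n → 2 * (C * ρ n) ≤ ε / 4 * (1 / 2) ^ (n - K) := by
    intro n hn
    have hnK : (n : ℝ) = K + (n - K : ℕ) := by exact_mod_cast (Nat.add_sub_cancel' hn).symm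
    have hKM : M + j ≤ K := by
      have := Nat.lt_floor_add_one M
      rw [hK]; push_cast; linarith
    have hj0 : (0 : ℝ) ≤ j := Nat.cast_nonneg j
    have hnk0 : (0 : ℝ) ≤ (n - K : ℕ) := Nat.cast_nonneg _
    have h1 := mulLogDiv_mul_exp_add_le ha0 hβ (x := n) (by rw [← hM]; linarith)
    rw [← hM, ← hL] at h1
    have h2 : Real.exp (L - mulLogDiv a n) ≤ Real.exp (-j) * Real.exp (-1) ^ (n - K) := by
      rw [← Real.exp_nat_mul, ← Real.exp_add]
      refine Real.exp_le_exp.2 ?_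
      linarith
    have h3 : Real.exp (-1) ≤ 1 / 2 := by
      rw [Real.exp_neg, ← one_div]
      have := Real.add_one_le_exp 1
      gcongr
      linarith
    have h4 : C * Real.exp (-j) ≤ 1 / 8 := by
      rw [Real.exp_neg, ← div_eq_mul_inv, div_le_iff₀ (Real.exp_pos _)]
      linarith
    rw [hρε]
    calc 2 * (C * (ε * Real.exp (L - mulLogDiv a n)))
        ≤ 2 * (C * (ε * (Real.exp (-j) * (1 / 2) ^ (n - K)))) := by
          gcongr
          exact h2.trans (by gcongr)
      _ = 2 * ε * (1 / 2) ^ (n - K) * (C * Real.exp (-j)) := by ring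
      _ ≤ 2 * ε * (1 / 2) ^ (n - K) * (1 / 8) := by gcongr
      _ = ε / 4 * (1 / 2) ^ (n - K) := by ring
  let I : ℕ → Finset ℤ := fun n => Finset.Icc ⌊-(C * ρ n / δ)⌋ ⌊C * ρ n / δ⌋
  let s : Finset (Fin K → ℤ × ℤ) := Fintype.piFinset fun n => I n ×ˢ I n
  let code : expTypeClass A C → Fin K → ℤ × ℤ :=
    fun f n => (⌊(f.1.coeff n).re / δ⌋, ⌊(f.1.coeff n).im / δ⌋)
  have hcode : ∀ f, code f ∈ s := by
    intro f
    rw [Fintype.mem_piFinset]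
    intro n
    rw [Finset.mem_product]
    exact ⟨floor_div_mem_Icc hδ0 ((Complex.abs_re_le_norm _).trans (hcoef f n)),
      floor_div_mem_Icc hδ0 ((Complex.abs_im_le_norm _).trans (hcoef f n))⟩
  have hdist : ∀ f g, code f = code g → edist (ι f) (ι g) ≤ ε.toNNReal := by
    intro f g hfg
    rw [hι.edist_eq, edist_nndist, ENNReal.coe_le_coe, ← NNReal.coe_le_coe, coe_nndist,
      Real.coe_toNNReal _ hε0.le, Subtype.dist_eq]
    refine EntireFunction.dist_le_of_hasSum (hasSum_const_geometric ε hK0) fun n => ?_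
    split_ifs with hn
    · have h := congrFun hfg ⟨n, hn⟩
      simp only [code, Prod.mk.injEq] at h
      refine (norm_sub_le_of_floor_eq hδ0 h.1 h.2).trans_eq ?_
      rw [hδ]
      field_simp
      norm_num
    · refine le_trans ?_ (htail n (not_lt.1 hn))
      have := norm_sub_le (f.1.coeff n) (g.1.coeff n)
      linarith [hcoef f n, hcoef g n]
  have hI : ∀ n, 0 < (I n).card := by
    intro n
    have h0 : 0 ≤ C * ρ n / δ := div_nonneg (mul_nonneg hC.le (hρ0 n)) hδ0.le
    exact Finset.card_pos.2 (Finset.nonempty_Icc.2 (Int.floor_mono (by linarith)))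
  have hcard : s.card = ∏ n ∈ Finset.range K, (I n).card ^ 2 := by
    rw [Fintype.card_piFinset, Finset.prod_range]
    simp only [Finset.card_product, sq]
  have hpos : 0 < s.card := by
    rw [hcard]
    exact Finset.prod_pos fun n _ => pow_pos (hI n) 2
  refine ⟨s.card, hpos, externalCoveringNumber_range_le_card ι code s hcode hdist, ?_⟩
  set D : ℝ := 8 * C * K + 2 with hD
  have hD0 : 0 < D := by positivity
  -- The maximum with `0` keeps the bound valid for `n > M`, where the additive `2` of the cell
  -- count dominates the exponential.
  have hIle : ∀ n, ((I n).card : ℝ) ≤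
      Real.exp (Real.log D + max (L - mulLogDiv a n) 0) := by
    intro n
    have h0 : 0 ≤ C * ρ n / δ := div_nonneg (mul_nonneg hC.le (hρ0 n)) hδ0.le
    refine (card_Icc_floor_le h0).trans ?_
    have h1 : C * ρ n / δ = 4 * C * K * Real.exp (L - mulLogDiv a n) := by
      rw [hρε, hδ]
      field_simp
    have h2 : Real.exp (L - mulLogDiv a n) ≤ Real.exp (max (L - mulLogDiv a n) 0) :=
      Real.exp_le_exp.2 (le_max_left _ _)
    have h3 : 1 ≤ Real.exp (max (L - mulLogDiv a n) 0) := Real.one_le_exp (le_max_right _ _)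
    rw [h1, Real.exp_add, Real.exp_log hD0, hD]
    have h4 := mul_le_mul_of_nonneg_left h2 (show 0 ≤ 8 * C * K by positivity)
    nlinarith
  have hsum : ∑ n ∈ Finset.range K, max (L - mulLogDiv a n) 0 ≤
      M ^ 2 / 2 * (β + 1 / 2) + L + a * M := by
    refine le_trans (le_of_eq ?_) (sum_sub_mulLogDiv_le ha0 hM hL)
    rw [← Finset.sum_subset (s₁ := Finset.range (⌊M⌋₊ + 1))]
    · refine Finset.sum_congr rfl fun n hn => max_eq_left ?_
      have hn' : (n : ℝ) ≤ M := (Nat.le_floor_iff hM0.le).1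
        (Nat.lt_succ_iff.1 (Finset.mem_range.1 hn))
      have := mulLogDiv_le_of_le_mul_exp ha0 hβ (Nat.cast_nonneg n) (hn'.trans_eq hM)
      rw [← hM, ← hL] at this
      linarith
    · exact Finset.range_subset_range.2 (by omega)
    · intro n _ hn
      refine max_eq_right ?_
      have hn' : M ≤ n := (Nat.lt_of_floor_lt (by
        rw [Finset.mem_range, not_lt] at hn; omega)).le
      have := mulLogDiv_mul_exp_add_le ha0 hβ (hM.symm.trans_le hn')
      rw [← hM, ← hL] at this
      linarith
  have hN : (s.card : ℝ) ≤ Real.exp (∑ n ∈ Finset.range K,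
      2 * (Real.log D + max (L - mulLogDiv a n) 0)) := by
    rw [hcard, Real.exp_sum]
    push_cast
    refine Finset.prod_le_prod (fun n _ => by positivity) fun n _ => ?_
    rw [two_mul, Real.exp_add, ← sq]
    gcongr
    exact hIle n
  rw [Real.log_le_iff_le_exp (by exact_mod_cast hpos)]
  refine hN.trans (Real.exp_le_exp.2 ?_)
  rw [← Finset.mul_sum, Finset.sum_add_distrib, Finset.sum_const, Finset.card_range,
    nsmul_eq_mul]
  linarith

/-! ### Lower bound: a separated family of polynomials -/

theorem le_norm_mul_natCast_add_sub {r : ℝ} (hr : 0 ≤ r) {j k j' k' : ℕ}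
    (h : (j, k) ≠ (j', k')) :
    r ≤ ‖(r : ℂ) * (j + k * Complex.I) - (r : ℂ) * (j' + k' * Complex.I)‖ := by
  have key : ∀ m n : ℕ, m ≠ n → (1 : ℝ) ≤ |(m : ℝ) - n| := by
    intro m n hmn
    have : (1 : ℤ) ≤ |(m : ℤ) - n| := Int.one_le_abs (sub_ne_zero.2 (by exact_mod_cast hmn))
    exact_mod_cast this
  rw [← mul_sub, norm_mul, Complex.norm_real, Real.norm_of_nonneg hr]
  refine le_mul_of_one_le_right hr ?_
  by_cases hj : j = j'
  · have hk : k ≠ k' := fun hk => h (by rw [hj, hk])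
    refine (key k k' hk).trans (le_trans (le_of_eq ?_) (Complex.abs_im_le_norm _))
    simp
  · refine (key j j' hj).trans (le_trans (le_of_eq ?_) (Complex.abs_re_le_norm _))
    simp

open Metric in
theorem exists_nat_le_externalCoveringNumber {A C : ℝ} (hA : 0 < A) (hC : 0 < C)
    {X : Type*} [MetricSpace X] {ι : expTypeClass A C → X} (hι : Isometry ι)
    {ε β a M L : ℝ} (hβ : 0 ≤ β) (ha : a = Real.exp 1 * A / 2) (hM : M = a * Real.exp β)
    (hL : L = M * β) (hε : ε = Real.exp (-L)) :
    ∃ N : ℕ, 0 < N ∧ (N : ℕ∞) ≤ externalCoveringNumber ε.toNNReal (Set.range ι) ∧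
      M ^ 2 * (β + 1 / 2) - 2 * (L + a * M + 2 * a + M * |Real.log (C / 12)|) ≤ Real.log N := by
  have ha0 : 0 < a := by rw [ha]; positivity
  have hM0 : 0 < M := by rw [hM]; positivity
  have hε0 : 0 < ε := by rw [hε]; positivity
  set K : ℕ := ⌊M⌋₊ with hK
  -- A grid point has norm at most `3ε (J n + J n)`, hence the divisor `6 * ε`.
  set J : ℕ → ℕ := fun n => ⌊C / 2 * (a / n) ^ n / (6 * ε)⌋₊ with hJ
  have hJle : ∀ n, (J n : ℝ) * (6 * ε) ≤ C / 2 * (a / n) ^ n := by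
    intro n
    rw [← le_div_iff₀ (by positivity)]
    exact Nat.floor_le (by positivity)
  let T := ∀ n : Fin K, Fin (J n + 1) × Fin (J n + 1)
  let c : T → Fin K → ℂ := fun t n =>
    ((3 * ε : ℝ) : ℂ) * (((t n).1 : ℕ) + ((t n).2 : ℕ) * Complex.I)
  have hmem : ∀ t : T, EntireFunction.ofPolynomial (Polynomial.ofFn K (c t)) ∈
      expTypeClass A C := by
    intro t
    refine EntireFunction.ofPolynomial_mem_expTypeClass hA hC fun n => ?_
    rw [← ha]
    rcases lt_or_ge n K with hn | hn
    · rw [Polynomial.ofFn_coeff_eq_val_of_lt _ hn]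
      refine le_trans ?_ (hJle n)
      have h1 : ‖(((t ⟨n, hn⟩).1 : ℕ) : ℂ) + ((t ⟨n, hn⟩).2 : ℕ) * Complex.I‖ ≤
          (J n : ℝ) + J n := by
        refine (norm_add_le _ _).trans ?_
        rw [norm_mul, Complex.norm_I, mul_one, Complex.norm_natCast, Complex.norm_natCast]
        gcongr
        · exact Nat.lt_succ_iff.1 (t ⟨n, hn⟩).1.2
        · exact Nat.lt_succ_iff.1 (t ⟨n, hn⟩).2.2
      simp only [c]
      rw [norm_mul, Complex.norm_real, Real.norm_of_nonneg (by positivity)]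
      nlinarith
    · rw [Polynomial.ofFn_coeff_eq_zero_of_ge _ hn, norm_zero]
      positivity
  let p : T → X := fun t => ι ⟨_, hmem t⟩
  have hsep : ∀ t t', t ≠ t' →
      ((2 * ε.toNNReal : NNReal) : ENNReal) < edist (p t) (p t') := by
    intro t t' htt
    obtain ⟨n, hn⟩ := Function.ne_iff.1 htt
    rw [hι.edist_eq, edist_nndist, ENNReal.coe_lt_coe, ← NNReal.coe_lt_coe, coe_nndist,
      NNReal.coe_mul, NNReal.coe_ofNat, Real.coe_toNNReal _ hε0.le, Subtype.dist_eq]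
    refine lt_of_lt_of_le ?_ (EntireFunction.norm_coeff_sub_le_dist _ _ n)
    rw [EntireFunction.coeff_ofPolynomial, EntireFunction.coeff_ofPolynomial,
      Polynomial.ofFn_coeff_eq_val_of_lt _ n.2, Polynomial.ofFn_coeff_eq_val_of_lt _ n.2]
    -- Spacing `3ε` gives the strict separation by more than `2ε`.
    refine lt_of_lt_of_le (by linarith : 2 * ε < 3 * ε)
      (le_norm_mul_natCast_add_sub (by positivity) fun h => hn ?_)
    rw [Prod.mk.injEq] at h
    exact Prod.ext (Fin.ext h.1) (Fin.ext h.2)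
  have hcard : Fintype.card T = ∏ n ∈ Finset.range K, (J n + 1) ^ 2 := by
    rw [Fintype.card_pi, Finset.prod_range]
    simp only [Fintype.card_prod, Fintype.card_fin, sq]
  have hpos : 0 < Fintype.card T := by
    rw [hcard]
    exact Finset.prod_pos fun n _ => by positivity
  refine ⟨Fintype.card T, hpos,
    card_le_externalCoveringNumber p (fun t => ⟨_, rfl⟩) hsep, ?_⟩
  have hJge : ∀ n : ℕ, Real.exp (Real.log (C / 12) + (L - mulLogDiv a n)) ≤ (J n : ℝ) + 1 := by
    intro n
    refine le_trans (le_of_eq ?_) (Nat.lt_floor_add_one _).le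
    rw [← exp_neg_mulLogDiv ha0, Real.exp_add, Real.exp_log (by positivity), hε, Real.exp_neg L,
      sub_eq_add_neg, Real.exp_add]
    field_simp
    norm_num
  rw [Real.le_log_iff_exp_le (by exact_mod_cast hpos)]
  have hN : Real.exp (∑ n ∈ Finset.range K, 2 * (Real.log (C / 12) + (L - mulLogDiv a n))) ≤
      (Fintype.card T : ℝ) := by
    rw [hcard, Real.exp_sum]
    push_cast
    refine Finset.prod_le_prod (fun n _ => by positivity) fun n _ => ?_
    rw [two_mul, Real.exp_add, ← sq]
    gcongr
    exact hJge n
  refine le_trans (Real.exp_le_exp.2 ?_) hN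
  rw [← Finset.mul_sum, Finset.sum_add_distrib, Finset.sum_const, Finset.card_range,
    nsmul_eq_mul]
  have h1 := le_sum_sub_mulLogDiv ha0 hβ hM hL
  -- The sign of `log (C / 12)` is unknown, so its absolute value is charged for each coefficient.
  have h2 : -(M * |Real.log (C / 12)|) ≤ K * Real.log (C / 12) := by
    have h3 := neg_abs_le (Real.log (C / 12))
    have h4 : (K : ℝ) ≤ M := Nat.floor_le hM0.le
    have h5 := mul_le_mul_of_nonneg_left h3 (Nat.cast_nonneg (α := ℝ) K)
    have h6 := mul_le_mul_of_nonneg_right h4 (abs_nonneg (Real.log (C / 12)))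
    linarith
  linarith

/-! ### Absorbing the errors into a factor `1 + O(e^{-β})` -/

/-- Coefficient of the relative error in the lower entropy bound. -/
noncomputable def lowerErrorConst (a C : ℝ) : ℝ := 2 * (5 + 2 * a + 2 * |Real.log (C / 12)|) / a

/-- Coefficient of the relative error in the upper entropy bound. -/
noncomputable def upperErrorConst (a C : ℝ) (j : ℕ) : ℝ :=
  2 * (1 + 2 * a + (1 + (1 + j) / a) *
    (1 + 2 * Real.log (8 * C * (1 + (1 + j) / a) * a + 2))) / a

/-- Because `e^{-β} / a = 1 / M`, the relative error is a constant over `M`. The constants are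
doubled since `β + 1/2 ≥ 1/2`, and `2a ≤ 2M` is absorbed by the `5`. -/
theorem lower_error_le {a C β M : ℝ} (ha : 0 < a) (hβ : 0 ≤ β) (hM : M = a * Real.exp β) :
    M ^ 2 * (β + 1 / 2) * (1 + -(lowerErrorConst a C * Real.exp (-β))) ≤
      M ^ 2 * (β + 1 / 2) - 2 * (M * β + a * M + 2 * a + M * |Real.log (C / 12)|) := by
  have hM0 : 0 < M := by rw [hM]; positivity
  have haM : a ≤ M := by
    rw [hM]
    exact le_mul_of_one_le_right ha.le (Real.one_le_exp hβ)
  have h1 : M * (lowerErrorConst a C * Real.exp (-β)) =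
      2 * (5 + 2 * a + 2 * |Real.log (C / 12)|) := by
    rw [lowerErrorConst, hM, Real.exp_neg]
    field_simp
  have h2 : 0 ≤ |Real.log (C / 12)| := abs_nonneg _
  set l := |Real.log (C / 12)|
  have h3 : M ^ 2 * (β + 1 / 2) * (lowerErrorConst a C * Real.exp (-β)) =
      M * (β + 1 / 2) * (2 * (5 + 2 * a + 2 * l)) := by
    rw [← h1]; ring
  have h4 : 0 ≤ M * β * a := by positivity
  have h5 : 0 ≤ M * β * l := by positivity
  have h6 : 0 ≤ M * β := by positivity
  linarith

/-- Here `K ≤ κ M` with `κ` independent of `β`, so `log (8CK + 2)` is at most `β` plus a constant.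
-/
theorem upper_error_le {a C β M : ℝ} {j K : ℕ} (ha : 0 < a) (hC : 0 < C) (hβ : 0 ≤ β)
    (hM : M = a * Real.exp β) (hK : K = ⌊M⌋₊ + 1 + j) :
    M ^ 2 * (β + 1 / 2) + 2 * (M * β + a * M) + 2 * K * Real.log (8 * C * K + 2) ≤
      M ^ 2 * (β + 1 / 2) * (1 + upperErrorConst a C j * Real.exp (-β)) := by
  have hM0 : 0 < M := by rw [hM]; positivity
  have haM : a ≤ M := by
    rw [hM]
    exact le_mul_of_one_le_right ha.le (Real.one_le_exp hβ)
  set κ : ℝ := 1 + (1 + j) / a with hκ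
  have hκ0 : 0 < κ := by positivity
  have hKκ : (K : ℝ) ≤ κ * M := by
    have h := Nat.floor_le hM0.le
    have h' : (1 + j : ℝ) ≤ (1 + j) / a * M := by
      rw [div_mul_eq_mul_div, le_div_iff₀ ha]
      gcongr
    rw [hK, hκ]
    push_cast
    linarith
  set D : ℝ := 8 * C * κ * a + 2 with hD
  have hD1 : 1 ≤ D := by
    have : 0 ≤ 8 * C * κ * a := by positivity
    linarith
  have hl : 0 ≤ Real.log D := Real.log_nonneg hD1
  have hlog : Real.log (8 * C * K + 2) ≤ β + Real.log D := by
    rw [Real.log_le_iff_le_exp (by positivity), Real.exp_add, Real.exp_log (by linarith)]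
    have h := Real.one_le_exp hβ
    have h' := mul_le_mul_of_nonneg_left hKκ (show 0 ≤ 8 * C by positivity)
    rw [hM] at h'
    rw [hD]
    linarith
  have hlog0 : 0 ≤ β + Real.log D := by linarith
  have h1 : M * (upperErrorConst a C j * Real.exp (-β)) =
      2 * (1 + 2 * a + κ * (1 + 2 * Real.log D)) := by
    rw [upperErrorConst, ← hκ, ← hD, hM, Real.exp_neg]
    field_simp
  have h3 : M ^ 2 * (β + 1 / 2) * (upperErrorConst a C j * Real.exp (-β)) =
      M * (β + 1 / 2) * (2 * (1 + 2 * a + κ * (1 + 2 * Real.log D))) := by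
    rw [← h1]; ring
  have h4 : K * Real.log (8 * C * K + 2) ≤ κ * M * (β + Real.log D) :=
    (mul_le_mul_of_nonneg_left hlog (Nat.cast_nonneg K)).trans
      (mul_le_mul_of_nonneg_right hKκ hlog0)
  have h5 : 0 ≤ M * β * a := by positivity
  have h6 : 0 ≤ κ * M * β * Real.log D := by positivity
  have h7 : 0 ≤ κ * M := by positivity
  linarith

/-! ### Lambert's equation and the conclusion -/

theorem eq_exp_neg_of_eq_lambertW {a ε β M : ℝ} (ha : 0 < a) (hε : 0 < ε) (hε1 : ε ≤ 1)
    (hβ : β = lambertW (Real.log ε⁻¹ / a)) (hM : M = a * Real.exp β) :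
    0 ≤ β ∧ ε = Real.exp (-(M * β)) := by
  have h0 : 0 ≤ Real.log ε⁻¹ := Real.log_nonneg ((one_le_inv₀ hε).2 hε1)
  refine ⟨hβ ▸ lambertW_nonneg _, ?_⟩
  have h := lambertW_mul_exp (div_nonneg h0 ha.le)
  rw [← hβ, eq_div_iff ha.ne'] at h
  have h' : M * β = Real.log ε⁻¹ := by rw [← h, hM]; ring
  rw [h', Real.log_inv, neg_neg, Real.exp_log hε]

theorem mainTheorem7 (A C : ℝ) (hA : 0 < A) (hC : 0 < C) :
    ∃ R₁ R₂ : ℝ → ℝ,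
      R₁ =O[Filter.atTop] (fun β : ℝ => Real.exp (-β)) ∧
      R₂ =O[Filter.atTop] (fun β : ℝ => Real.exp (-β)) ∧
      ∀ (X : Type*) [MetricSpace X] (ι : expTypeClass A C → X), Isometry ι →
        ∀ ε β₁ β₂ : ℝ, 0 < ε → ε ≤ 1 →
          β₁ = lambertW (2 * Real.log ε⁻¹ / (Real.exp 1 * A)) →
          β₂ = lambertW (Real.log ε⁻¹ / (Real.exp 1 * A)) →
          Metric.externalCoveringNumber ε.toNNReal (Set.range ι) ≠ ⊤ ∧
          (Real.exp 1 * A / 2) ^ 2 * (Real.exp (2 * β₁) / Real.log 2) * (β₁ + 1 / 2) *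
              (1 + R₁ β₁) ≤ metricEntropy ε (Set.range ι) ∧
          metricEntropy ε (Set.range ι) ≤
            (Real.exp 1 * A) ^ 2 * (Real.exp (2 * β₂) / Real.log 2) * (β₂ + 1 / 2) *
              (1 + R₂ β₂) := by
  set a₂ : ℝ := Real.exp 1 * A with ha₂
  set a₁ : ℝ := a₂ / 2 with ha₁
  have ha₂0 : 0 < a₂ := by positivity
  have ha₁0 : 0 < a₁ := by positivity
  obtain ⟨j, hj⟩ : ∃ j : ℕ, 8 * C ≤ Real.exp j := by
    obtain ⟨j, hj⟩ := exists_nat_ge (8 * C)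
    exact ⟨j, hj.trans (by linarith [Real.add_one_le_exp (j : ℝ)])⟩
  refine ⟨fun β => -(lowerErrorConst a₁ C * Real.exp (-β)),
    fun β => upperErrorConst a₂ C j * Real.exp (-β),
    (Asymptotics.isBigO_const_mul_self _ _ _).neg_left,
    Asymptotics.isBigO_const_mul_self _ _ _, ?_⟩
  intro X _ ι hι ε β₁ β₂ hε hε1 hβ₁ hβ₂
  -- The factor `2` in `β₁` is the halved constant `a₁ = eA/2`.
  have harg : 2 * Real.log ε⁻¹ / a₂ = Real.log ε⁻¹ / a₁ := by rw [ha₁]; field_simp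
  rw [harg] at hβ₁
  obtain ⟨hβ₁0, hε₁⟩ := eq_exp_neg_of_eq_lambertW ha₁0 hε hε1 hβ₁ rfl
  obtain ⟨hβ₂0, hε₂⟩ := eq_exp_neg_of_eq_lambertW ha₂0 hε hε1 hβ₂ rfl
  obtain ⟨N₁, hN₁, hN₁le, hlog₁⟩ :=
    exists_nat_le_externalCoveringNumber hA hC hι hβ₁0 ha₁ rfl rfl hε₁
  obtain ⟨N₂, hN₂, hN₂le, hlog₂⟩ :=
    exists_nat_externalCoveringNumber_le hA hC hι hβ₂0 ha₂ rfl rfl hε₂ hj rfl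
  have htop : Metric.externalCoveringNumber ε.toNNReal (Set.range ι) ≠ ⊤ :=
    ne_top_of_le_ne_top (ENat.natCast_ne_top _) hN₂le
  have hl2 : 0 < Real.log 2 := Real.log_pos one_lt_two
  unfold metricEntropy
  generalize Metric.externalCoveringNumber ε.toNNReal (Set.range ι) = E at *
  lift E to ℕ using htop
  rw [ENat.toNat_natCast]
  have hN₁E : N₁ ≤ E := by exact_mod_cast hN₁le
  have hEN₂ : E ≤ N₂ := by exact_mod_cast hN₂le
  have hmain : ∀ a β R : ℝ, a ^ 2 * (Real.exp (2 * β) / Real.log 2) * (β + 1 / 2) * (1 + R) =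
      (a * Real.exp β) ^ 2 * (β + 1 / 2) * (1 + R) / Real.log 2 := by
    intro a β R
    rw [two_mul, Real.exp_add]
    ring
  refine ⟨ENat.natCast_ne_top _, ?_, ?_⟩
  · rw [hmain, Real.logb]
    gcongr
    refine (lower_error_le ha₁0 hβ₁0 rfl).trans (hlog₁.trans ?_)
    exact Real.log_le_log (by exact_mod_cast hN₁) (by exact_mod_cast hN₁E)
  · rw [hmain, Real.logb]
    gcongr
    refine le_trans ?_ (hlog₂.trans (upper_error_le ha₂0 hC hβ₂0 rfl rfl))
    exact Real.log_le_log (by exact_mod_cast hN₁.trans_le hN₁E) (by exact_mod_cast hEN₂)
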